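/- A dyadic grid $\mathcal D$ on $\mathbb R$ is a collection of intervals such that every $I\in\mathcal D$ has length $|I|=2^k$ for some $k\in\mathbb Z$, for each $k\in\mathbb Z$ the members of length $2^k$ form a partition of $\mathbb R$, and any two members are either disjoint or one contains the other. For $I\in\mathcal D$ let $h_I=|I|^{-1/2}(\mathbf 1_{I_+}-\mathbf 1_{I_-})$ be the Haar function, where $I_+$ and $I_-$ are the right and left halves of $I$, and put $(f,h_I)=\int_{\mathbb R} f h_I\,dx$. For $s>0$ and real-valued $f\in L^2(\mathbb R)$ let \[ D^s_{\mathcal D}f=\sum_{I\in\mathcal D}|I|^{-s}(f,h_I)\,h_I ,\qquad H^s_{\mathcal D}(\mathbb R)=\{f\in L^2(\mathbb R): D^s_{\mathcal D}f\in L^2(\mathbb R)\},\qquad \|f\|_{\dot H^s_{\mathcal D}}=\|D^s_{\mathcal D}f\|_{L^2(\mathbb R)}, \] where $D^s_{\mathcal D}f\in L^2(\mathbb R)$ means that the series converges (unconditionally) in $L^2(\mathbb R)$, and let $\mathscr S_{\mathcal D}(\mathbb R)=\mathrm{span}\{h_I: I\in\mathcal D\}$. Let $0<s<\tfrac12$ and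 $q=\frac{2}{1-2s}$. Then there is a constant $C>0$, depending only on $s$, such that for every dyadic grid $\mathcal D$ on $\mathbb R$: 1. $\mathscr S_{\mathcal D}(\mathbb R)\subseteq H^s_{\mathcal D}(\mathbb R)$, and $\|f\|_{L^q(\mathbb R)}\le C\,\|f\|_{\dot H^s_{\mathcal D}}$ for every $f\in\mathscr S_{\mathcal D}(\mathbb R)$; 2. $H^s_{\mathcal D}(\mathbb R)\subseteq L^{q}(\mathbb R)$, with $\|f\|_{L^q(\mathbb R)}\le C\,\|f\|_{\dot H^s_{\mathcal D}}$ for every $f\in H^s_{\mathcal D}(\mathbb R)$. -/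

import Mathlib

open MeasureTheory
open scoped ENNReal

noncomputable section

/-- A dyadic grid on `ℝ`: a collection of intervals (open, closed or half-open) whose lengths are
integer powers of `2`, such that for each `k : ℤ` the members of length `2 ^ k` partition `ℝ`, and
any two members are disjoint or nested. -/
structure DyadicGrid where
  intervals : Set (Set ℝ)
  isInterval : ∀ I ∈ intervals, I.OrdConnected
  length_eq : ∀ I ∈ intervals, ∃ k : ℤ, volume I = ENNReal.ofReal ((2 : ℝ) ^ k)
  partition : ∀ k : ℤ,
    Setoid.IsPartition {I ∈ intervals | volume I = ENNReal.ofReal ((2 : ℝ) ^ k)}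
  nested : ∀ I ∈ intervals, ∀ J ∈ intervals, I ∩ J = ∅ ∨ I ∩ J = I ∨ I ∩ J = J

namespace DyadicGrid

/-- The midpoint of a bounded interval. -/
def midpoint (I : Set ℝ) : ℝ := (sInf I + sSup I) / 2

/-- The left half `I₋` of an interval. -/
def leftHalf (I : Set ℝ) : Set ℝ := I ∩ Set.Iio (midpoint I)

/-- The right half `I₊` of an interval. -/
def rightHalf (I : Set ℝ) : Set ℝ := I ∩ Set.Ici (midpoint I)

/-- The Haar function `h_I = |I|^{-1/2} (1_{I₊} - 1_{I₋})`. -/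
def haar (I : Set ℝ) (x : ℝ) : ℝ :=
  (1 / √(volume.real I)) *
    ((rightHalf I).indicator (fun _ => (1 : ℝ)) x - (leftHalf I).indicator (fun _ => (1 : ℝ)) x)

theorem memLp_haar (𝒟 : DyadicGrid) {I : Set ℝ} (hI : I ∈ 𝒟.intervals) :
    MemLp (haar I) 2 volume := by
  have hm : MeasurableSet I := (𝒟.isInterval I hI).measurableSet
  have hfin : volume I ≠ ∞ := by
    obtain ⟨k, hk⟩ := 𝒟.length_eq I hI
    rw [hk]
    exact ENNReal.ofReal_ne_top
  have hr : MemLp ((rightHalf I).indicator (fun _ => (1 : ℝ))) 2 volume :=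
    memLp_indicator_const 2 (hm.inter measurableSet_Ici) 1
      (Or.inr (measure_ne_top_of_subset Set.inter_subset_left hfin))
  have hl : MemLp ((leftHalf I).indicator (fun _ => (1 : ℝ))) 2 volume :=
    memLp_indicator_const 2 (hm.inter measurableSet_Iio) 1
      (Or.inr (measure_ne_top_of_subset Set.inter_subset_left hfin))
  exact (hr.sub hl).const_mul (1 / √(volume.real I))

variable (𝒟 : DyadicGrid)

/-- The Haar function `h_I`, `I ∈ 𝒟`, as an element of `L²(ℝ)`. -/
def haarL2 (I : 𝒟.intervals) : Lp ℝ 2 (volume : Measure ℝ) :=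
  (𝒟.memLp_haar I.2).toLp (haar (I : Set ℝ))

/-- The Haar span, which plays the role of the Schwartz functions. -/
def haarSpan : Submodule ℝ (Lp ℝ 2 (volume : Measure ℝ)) :=
  Submodule.span ℝ (Set.range 𝒟.haarL2)

/-- The Haar coefficient `(f, h_I) = ∫ f h_I dx`. -/
def haarCoeff (f : Lp ℝ 2 (volume : Measure ℝ)) (I : 𝒟.intervals) : ℝ :=
  ∫ x, f x * haar (I : Set ℝ) x

/-- The term `|I|^{-s} (f, h_I) h_I` of the series for the dyadic fractional derivative. -/
def fracDerivTerm (s : ℝ) (f : Lp ℝ 2 (volume : Measure ℝ)) (I : 𝒟.intervals) :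
    Lp ℝ 2 (volume : Measure ℝ) :=
  (volume.real (I : Set ℝ) ^ (-s) * 𝒟.haarCoeff f I) • 𝒟.haarL2 I

/-- The dyadic fractional derivative `D^s f = ∑_{I ∈ 𝒟} |I|^{-s} (f, h_I) h_I`, a series in `L²(ℝ)`
(meaningful when the series converges, i.e. when `f` is in `sobolev 𝒟 s`). -/
def fracDeriv (s : ℝ) (f : Lp ℝ 2 (volume : Measure ℝ)) : Lp ℝ 2 (volume : Measure ℝ) :=
  ∑' I : 𝒟.intervals, 𝒟.fracDerivTerm s f I

/-- The dyadic fractional Sobolev space `H^s`: the `f ∈ L²(ℝ)` with `D^s f ∈ L²(ℝ)`, i.e. such that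
the (orthogonal) series defining `D^s f` converges in `L²(ℝ)`. -/
def sobolev (s : ℝ) : Set (Lp ℝ 2 (volume : Measure ℝ)) :=
  {f | Summable (𝒟.fracDerivTerm s f)}

/-- The homogeneous seminorm `‖D^s f‖_{L²}`. -/
def homSeminorm (s : ℝ) (f : Lp ℝ 2 (volume : Measure ℝ)) : ℝ :=
  ‖𝒟.fracDeriv s f‖

end DyadicGrid

end

/-!
The averages of `f` over the intervals of the grid containing `x` form a two-sided sequence indexed
by scale; by Lebesgue differentiation it tends to `f x` at small scales, and it tends to `0` at
large scales. Two consecutive averages differ by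
`|(f, h_I)| |I|^{-1/2} = |I|^s |(g, h_I)| |I|^{-1/2}` with `g = D^s f`. This is at most
`|I|^s S(g)(x)`, where `S(g)` is the dyadic square function, and, by Cauchy–Schwarz, at most
`|I|^{s - 1/2} ‖g‖`. Summing the first bound over the scales below a threshold and the second one
above it, and optimizing the threshold, gives Hedberg's inequality
`|f| ≤ C S(g)^{1 - 2s} ‖g‖^{2s}`. The `L^q` norm of `f` is at most `C ‖g‖`, because
`(1 - 2s) q = 2` and `‖S(g)‖ ≤ ‖g‖` by Bessel's inequality.
-/

open Filter Set
open scoped Topology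

section Telescoping

variable {E : Type*} [PseudoMetricSpace E] {a : ℤ → E} {x y : E}

theorem dist_le_of_dist_le_zpow_of_tendsto_atTop {r C : ℝ} (hr0 : 0 < r) (hr1 : r < 1)
    (h : ∀ k, dist (a (k - 1)) (a k) ≤ C * r ^ k) (ha : Tendsto a atTop (𝓝 y)) (N : ℤ) :
    dist (a N) y ≤ C * r ^ (N + 1) / (1 - r) := by
  have hstep (n : ℕ) : dist (a (N + n)) (a (N + (n + 1 : ℕ))) ≤ C * r ^ (N + 1) * r ^ n := by
    convert h (N + (n + 1 : ℕ)) using 1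
    · congr 2
      push_cast
      ring
    · rw [mul_assoc, ← zpow_natCast r n, ← zpow_add₀ hr0.ne']
      congr 2
      push_cast
      ring
  simpa using dist_le_of_le_geometric_of_tendsto₀ r _ (f := fun n : ℕ => a (N + n)) hr1 hstep
    (ha.comp (tendsto_atTop_add_const_left _ N tendsto_natCast_atTop_atTop))

theorem dist_le_of_dist_le_zpow_of_tendsto_atBot {r C : ℝ} (hr : 1 < r)
    (h : ∀ k, dist (a (k - 1)) (a k) ≤ C * r ^ k) (ha : Tendsto a atBot (𝓝 x)) (N : ℤ) :
    dist (a N) x ≤ C * r ^ N / (1 - r⁻¹) := by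
  have hr0 : r ≠ 0 := by positivity
  have hreflect (k : ℤ) : dist (a (-(k - 1))) (a (-k)) ≤ C * r * r⁻¹ ^ k := by
    rw [dist_comm, show -k = -(k - 1) - 1 by ring, mul_assoc, inv_zpow', ← zpow_one_add₀ hr0]
    convert h (-(k - 1)) using 3
    ring
  have := dist_le_of_dist_le_zpow_of_tendsto_atTop (a := fun k => a (-k)) (by positivity)
    (inv_lt_one_of_one_lt₀ hr) hreflect (ha.comp tendsto_neg_atTop_atBot) (-N)
  rwa [neg_neg, mul_assoc, inv_zpow', ← zpow_one_add₀ hr0, show 1 + -(-N + 1) = N by ring] at this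

theorem dist_le_of_dist_le_zpow_of_tendsto {r₁ r₂ C₁ C₂ : ℝ} (hr₁ : 1 < r₁) (hr₂0 : 0 < r₂)
    (hr₂1 : r₂ < 1) (h₁ : ∀ k, dist (a (k - 1)) (a k) ≤ C₁ * r₁ ^ k)
    (h₂ : ∀ k, dist (a (k - 1)) (a k) ≤ C₂ * r₂ ^ k)
    (hx : Tendsto a atBot (𝓝 x)) (hy : Tendsto a atTop (𝓝 y)) (N : ℤ) :
    dist x y ≤ C₁ * r₁ ^ N / (1 - r₁⁻¹) + C₂ * r₂ ^ (N + 1) / (1 - r₂) :=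
  (dist_triangle_left x y (a N)).trans <| add_le_add
    (dist_le_of_dist_le_zpow_of_tendsto_atBot hr₁ h₁ hx N)
    (dist_le_of_dist_le_zpow_of_tendsto_atTop hr₂0 hr₂1 h₂ hy N)

/-- The constant in Hedberg's inequality for sequences of ratio `b`: the sum of the two geometric
series of ratios `b ^ (-α)` and `b ^ (-β)`. -/
noncomputable def hedbergConst (b α β : ℝ) : ℝ :=
  (1 - b ^ (-α))⁻¹ + (1 - b ^ (-β))⁻¹

theorem hedbergConst_pos {b α β : ℝ} (hb : 1 < b) (hα : 0 < α) (hβ : 0 < β) :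
    0 < hedbergConst b α β :=
  add_pos (inv_pos.2 (sub_pos.2 (Real.rpow_lt_one_of_one_lt_of_neg hb (neg_lt_zero.2 hα))))
    (inv_pos.2 (sub_pos.2 (Real.rpow_lt_one_of_one_lt_of_neg hb (neg_lt_zero.2 hβ))))

theorem div_rpow_mul_eq_rpow_mul_rpow {u v S G : ℝ} (huv : u + v = 1) (hS : 0 < S) (hG : 0 < G) :
    (G / S) ^ u * S = S ^ v * G ^ u := by
  rw [Real.div_rpow hG.le hS.le, eq_sub_of_add_eq' huv, Real.rpow_sub hS, Real.rpow_one]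
  ring

variable {b α β S G : ℝ}

theorem dist_le_of_increments_le (hb : 1 < b) (hα : 0 < α) (hβ : 0 < β)
    (hS : ∀ k, dist (a (k - 1)) (a k) ≤ (b ^ k) ^ α * S)
    (hG : ∀ k, dist (a (k - 1)) (a k) ≤ (b ^ k) ^ (-β) * G)
    (hx : Tendsto a atBot (𝓝 x)) (hy : Tendsto a atTop (𝓝 y)) (N : ℤ) :
    dist x y ≤ (1 - b ^ (-α))⁻¹ * ((b ^ N) ^ α * S) +
      (1 - b ^ (-β))⁻¹ * ((b ^ (N + 1)) ^ (-β) * G) := by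
  have hb0 : 0 < b := by positivity
  have hcomm (t : ℝ) (k : ℤ) : (b ^ k) ^ t = (b ^ t) ^ k := (Real.rpow_zpow_comm hb0.le t k).symm
  simp only [hcomm, mul_comm _ S, mul_comm _ G] at hS hG
  convert dist_le_of_dist_le_zpow_of_tendsto (Real.one_lt_rpow hb hα) (Real.rpow_pos_of_pos hb0 _)
    (Real.rpow_lt_one_of_one_lt_of_neg hb (neg_lt_zero.2 hβ)) hS hG hx hy N using 1
  rw [hcomm, hcomm, Real.rpow_neg hb0.le α]
  ring

/-- The threshold `N` with `b ^ N ≈ (G / S) ^ (1 / (α + β))` balances the two geometric sums. -/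
theorem dist_le_hedbergConst_mul_of_pos (hb : 1 < b) (hα : 0 < α) (hβ : 0 < β)
    (hS0 : 0 < S) (hG0 : 0 < G)
    (hS : ∀ k, dist (a (k - 1)) (a k) ≤ (b ^ k) ^ α * S)
    (hG : ∀ k, dist (a (k - 1)) (a k) ≤ (b ^ k) ^ (-β) * G)
    (hx : Tendsto a atBot (𝓝 x)) (hy : Tendsto a atTop (𝓝 y)) :
    dist x y ≤ hedbergConst b α β * (S ^ (β / (α + β)) * G ^ (α / (α + β))) := by
  have hsum : α + β ≠ 0 := by positivity
  have hα' : b ^ (-α) ≤ 1 := Real.rpow_le_one_of_one_le_of_nonpos hb.le (neg_nonpos.2 hα.le)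
  have hβ' : b ^ (-β) ≤ 1 := Real.rpow_le_one_of_one_le_of_nonpos hb.le (neg_nonpos.2 hβ.le)
  obtain ⟨N, hN, hN'⟩ :=
    exists_mem_Ico_zpow (x := (G / S) ^ (α + β)⁻¹) (y := b) (by positivity) hb
  have hlow : (b ^ N) ^ α * S ≤ S ^ (β / (α + β)) * G ^ (α / (α + β)) := by
    calc (b ^ N) ^ α * S ≤ ((G / S) ^ (α + β)⁻¹) ^ α * S := by gcongr
      _ = (G / S) ^ (α / (α + β)) * S := by
        rw [← Real.rpow_mul (by positivity), inv_mul_eq_div]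
      _ = S ^ (β / (α + β)) * G ^ (α / (α + β)) :=
        div_rpow_mul_eq_rpow_mul_rpow (by field_simp) hS0 hG0
  have hhigh : (b ^ (N + 1)) ^ (-β) * G ≤ S ^ (β / (α + β)) * G ^ (α / (α + β)) := by
    calc (b ^ (N + 1)) ^ (-β) * G ≤ ((G / S) ^ (α + β)⁻¹) ^ (-β) * G := by
          gcongr ?_ * G
          exact Real.rpow_le_rpow_of_nonpos (by positivity) hN'.le (neg_nonpos.2 hβ.le)
      _ = (S / G) ^ (β / (α + β)) * G := by
        rw [← Real.rpow_mul (by positivity), inv_mul_eq_div, neg_div, Real.rpow_neg (by positivity),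
          ← Real.inv_rpow (by positivity), inv_div]
      _ = S ^ (β / (α + β)) * G ^ (α / (α + β)) := by
        rw [div_rpow_mul_eq_rpow_mul_rpow (v := α / (α + β)) (by field_simp; ring) hG0 hS0,
          mul_comm]
  rw [hedbergConst, add_mul]
  refine (dist_le_of_increments_le hb hα hβ hS hG hx hy N).trans (add_le_add ?_ ?_)
  · exact mul_le_mul_of_nonneg_left hlow (inv_nonneg.2 (sub_nonneg.2 hα'))
  · exact mul_le_mul_of_nonneg_left hhigh (inv_nonneg.2 (sub_nonneg.2 hβ'))

theorem dist_le_hedbergConst_mul (hb : 1 < b) (hα : 0 < α) (hβ : 0 < β)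
    (hS0 : 0 ≤ S) (hG0 : 0 ≤ G)
    (hS : ∀ k, dist (a (k - 1)) (a k) ≤ (b ^ k) ^ α * S)
    (hG : ∀ k, dist (a (k - 1)) (a k) ≤ (b ^ k) ^ (-β) * G)
    (hx : Tendsto a atBot (𝓝 x)) (hy : Tendsto a atTop (𝓝 y)) :
    dist x y ≤ hedbergConst b α β * (S ^ (β / (α + β)) * G ^ (α / (α + β))) := by
  by_cases hpos : 0 < S ∧ 0 < G
  · exact dist_le_hedbergConst_mul_of_pos hb hα hβ hpos.1 hpos.2 hS hG hx hy
  have hconst (k : ℤ) : dist (a (k - 1)) (a k) ≤ 0 := by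
    rcases not_and_or.1 hpos with h | h
    · simpa [hS0.antisymm' (not_lt.1 h)] using hS k
    · simpa [hG0.antisymm' (not_lt.1 h)] using hG k
  have hzero : dist x y ≤ 0 := by
    simpa using dist_le_of_increments_le (S := 0) (G := 0) hb hα hβ (by simpa using hconst)
      (by simpa using hconst) hx hy 0
  have := hedbergConst_pos hb hα hβ
  exact hzero.trans (by positivity)

end Telescoping

section MeasureTheory

variable {X : Type*} [MeasurableSpace X] {μ : Measure X}

theorem eLpNorm_le_mul_eLpNorm_rpow {F G : Type*} [NormedAddCommGroup F] [NormedAddCommGroup G]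
    {f : X → F} {g : X → G} {c r : ℝ} (hr : 0 < r) (h : ∀ᵐ x ∂μ, ‖f x‖ ≤ c * ‖g x‖ ^ r)
    (p : ℝ≥0∞) :
    eLpNorm f p μ ≤ ENNReal.ofReal c * eLpNorm g (p * ENNReal.ofReal r) μ ^ r := by
  rw [← eLpNorm_norm_rpow g hr]
  refine eLpNorm_le_mul_eLpNorm_of_ae_le_mul (h.mono fun x hx => hx.trans_eq ?_) p
  rw [Real.norm_of_nonneg (by positivity)]

theorem abs_setAverage_le_norm_div_sqrt {s : Set X} (hs : MeasurableSet s) (hfin : μ s ≠ ∞)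
    (f : Lp ℝ 2 μ) : |⨍ x in s, f x ∂μ| ≤ ‖f‖ / √(μ.real s) := by
  have hcauchy := abs_real_inner_le_norm (indicatorConstLp 2 hs hfin (1 : ℝ)) f
  rw [L2.inner_indicatorConstLp_one, norm_indicatorConstLp two_ne_zero ENNReal.ofNat_ne_top,
    norm_one, one_mul, ENNReal.toReal_ofNat, ← Real.sqrt_eq_rpow] at hcauchy
  rw [setAverage_eq, smul_eq_mul, abs_mul, abs_inv, abs_of_nonneg measureReal_nonneg]
  calc (μ.real s)⁻¹ * |∫ x in s, f x ∂μ| ≤ (μ.real s)⁻¹ * (√(μ.real s) * ‖f‖) := by gcongr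
    _ = ‖f‖ / √(μ.real s) := by
      rw [← mul_assoc, inv_mul_eq_div, Real.sqrt_div_self, inv_mul_eq_div]

theorem ae_eq_Icc_of_Ioo_subset_of_subset_Icc {a b : ℝ} {s : Set ℝ} (h₁ : Ioo a b ⊆ s)
    (h₂ : s ⊆ Icc a b) : s =ᵐ[volume] Icc a b :=
  EventuallyLE.antisymm h₂.eventuallyLE (Ioo_ae_eq_Icc.symm.le.trans h₁.eventuallyLE)

end MeasureTheory

theorem csSup_le_csInf_of_disjoint {α : Type*} [ConditionallyCompleteLinearOrder α] {s t : Set α}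
    (hs : s.OrdConnected) (ht : t.OrdConnected) (hst : Disjoint s t) {x y : α} (hx : x ∈ s)
    (hy : y ∈ t) (hxy : x ≤ y) : sSup s ≤ sInf t := by
  refine csSup_le ⟨x, hx⟩ fun u hu => le_csInf ⟨y, hy⟩ fun v hv => le_of_not_gt fun hvu => ?_
  rcases le_total v x with hvx | hxv
  · exact disjoint_left.1 hst hx (ht.out hv hy ⟨hvx, hxy⟩)
  · exact disjoint_left.1 hst (hs.out hx hu ⟨hxv, hvu.le⟩) hv

namespace DyadicGrid

section Interval

variable {I : Set ℝ}

theorem sub_le_volume_real (hI : I.OrdConnected) (hfin : volume I ≠ ∞) {x y : ℝ} (hx : x ∈ I)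
    (hy : y ∈ I) : y - x ≤ volume.real I := by
  calc y - x ≤ volume.real (Icc x y) := by
        rw [Real.volume_real_Icc]
        exact le_max_left _ _
    _ ≤ volume.real I := measureReal_mono (hI.out hx hy) hfin

theorem bddAbove_of_volume_ne_top (hI : I.OrdConnected) (hfin : volume I ≠ ∞) : BddAbove I := by
  rcases I.eq_empty_or_nonempty with rfl | ⟨x, hx⟩
  · exact bddAbove_empty
  · exact ⟨x + volume.real I, fun y hy => by linarith [sub_le_volume_real hI hfin hx hy]⟩

theorem bddBelow_of_volume_ne_top (hI : I.OrdConnected) (hfin : volume I ≠ ∞) : BddBelow I := by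
  rcases I.eq_empty_or_nonempty with rfl | ⟨x, hx⟩
  · exact bddBelow_empty
  · exact ⟨x - volume.real I, fun y hy => by linarith [sub_le_volume_real hI hfin hy hx]⟩

theorem sInf_le_sSup_of_volume_ne_top (hI : I.OrdConnected) (hfin : volume I ≠ ∞) :
    sInf I ≤ sSup I :=
  Real.sInf_le_sSup I (bddBelow_of_volume_ne_top hI hfin) (bddAbove_of_volume_ne_top hI hfin)

theorem Ioo_sInf_sSup_subset (hI : I.OrdConnected) (hfin : volume I ≠ ∞) :
    Ioo (sInf I) (sSup I) ⊆ I := by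
  rcases I.eq_empty_or_nonempty with rfl | hne
  · simp
  · exact IsConnected.Ioo_csInf_csSup_subset ⟨hne, hI.isPreconnected⟩
      (bddBelow_of_volume_ne_top hI hfin) (bddAbove_of_volume_ne_top hI hfin)

theorem subset_Icc_sInf_sSup (hI : I.OrdConnected) (hfin : volume I ≠ ∞) :
    I ⊆ Icc (sInf I) (sSup I) :=
  subset_Icc_csInf_csSup (bddBelow_of_volume_ne_top hI hfin) (bddAbove_of_volume_ne_top hI hfin)

theorem ae_eq_Icc_sInf_sSup (hI : I.OrdConnected) (hfin : volume I ≠ ∞) :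
    I =ᵐ[volume] Icc (sInf I) (sSup I) :=
  ae_eq_Icc_of_Ioo_subset_of_subset_Icc (Ioo_sInf_sSup_subset hI hfin)
    (subset_Icc_sInf_sSup hI hfin)

theorem volume_real_eq_sSup_sub_sInf (hI : I.OrdConnected) (hfin : volume I ≠ ∞) :
    volume.real I = sSup I - sInf I := by
  rw [measureReal_congr (ae_eq_Icc_sInf_sSup hI hfin),
    Real.volume_real_Icc_of_le (sInf_le_sSup_of_volume_ne_top hI hfin)]

theorem sInf_le_midpoint (hI : I.OrdConnected) (hfin : volume I ≠ ∞) : sInf I ≤ midpoint I := by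
  have := sInf_le_sSup_of_volume_ne_top hI hfin
  unfold midpoint
  linarith

theorem midpoint_le_sSup (hI : I.OrdConnected) (hfin : volume I ≠ ∞) : midpoint I ≤ sSup I := by
  have := sInf_le_sSup_of_volume_ne_top hI hfin
  unfold midpoint
  linarith

theorem leftHalf_ae_eq_Icc (hI : I.OrdConnected) (hfin : volume I ≠ ∞) :
    leftHalf I =ᵐ[volume] Icc (sInf I) (midpoint I) :=
  ae_eq_Icc_of_Ioo_subset_of_subset_Icc
    (fun _ hx => ⟨Ioo_sInf_sSup_subset hI hfin
      ⟨hx.1, hx.2.trans_le (midpoint_le_sSup hI hfin)⟩, hx.2⟩)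
    fun _ hx => ⟨(subset_Icc_sInf_sSup hI hfin hx.1).1, le_of_lt hx.2⟩

theorem rightHalf_ae_eq_Icc (hI : I.OrdConnected) (hfin : volume I ≠ ∞) :
    rightHalf I =ᵐ[volume] Icc (midpoint I) (sSup I) :=
  ae_eq_Icc_of_Ioo_subset_of_subset_Icc
    (fun _ hx => ⟨Ioo_sInf_sSup_subset hI hfin
      ⟨(sInf_le_midpoint hI hfin).trans_lt hx.1, hx.2⟩, le_of_lt hx.1⟩)
    fun _ hx => ⟨hx.2, (subset_Icc_sInf_sSup hI hfin hx.1).2⟩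

theorem volume_real_leftHalf (hI : I.OrdConnected) (hfin : volume I ≠ ∞) :
    volume.real (leftHalf I) = volume.real I / 2 := by
  rw [measureReal_congr (leftHalf_ae_eq_Icc hI hfin), volume_real_eq_sSup_sub_sInf hI hfin,
    Real.volume_real_Icc_of_le (sInf_le_midpoint hI hfin), midpoint]
  ring

theorem volume_real_rightHalf (hI : I.OrdConnected) (hfin : volume I ≠ ∞) :
    volume.real (rightHalf I) = volume.real I / 2 := by
  rw [measureReal_congr (rightHalf_ae_eq_Icc hI hfin), volume_real_eq_sSup_sub_sInf hI hfin,
    Real.volume_real_Icc_of_le (midpoint_le_sSup hI hfin), midpoint]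
  ring

theorem disjoint_rightHalf_leftHalf : Disjoint (rightHalf I) (leftHalf I) :=
  disjoint_left.2 fun _ hr hl => (mem_Ici.1 hr.2).not_gt hl.2

theorem rightHalf_union_leftHalf : rightHalf I ∪ leftHalf I = I := by
  rw [rightHalf, leftHalf, ← inter_union_distrib_left, Ici_union_Iio, inter_univ]

theorem measurableSet_leftHalf (hI : I.OrdConnected) : MeasurableSet (leftHalf I) :=
  hI.measurableSet.inter measurableSet_Iio

theorem measurableSet_rightHalf (hI : I.OrdConnected) : MeasurableSet (rightHalf I) :=
  hI.measurableSet.inter measurableSet_Ici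

theorem haar_of_notMem {x : ℝ} (hx : x ∉ I) : haar I x = 0 := by
  simp [haar, rightHalf, leftHalf, hx]

theorem haar_of_mem_rightHalf {x : ℝ} (hx : x ∈ rightHalf I) :
    haar I x = 1 / √(volume.real I) := by
  simp [haar, hx, disjoint_left.1 disjoint_rightHalf_leftHalf hx]

theorem haar_of_mem_leftHalf {x : ℝ} (hx : x ∈ leftHalf I) :
    haar I x = -(1 / √(volume.real I)) := by
  simp [haar, hx, disjoint_right.1 disjoint_rightHalf_leftHalf hx]

theorem haar_mul_self (x : ℝ) :
    haar I x * haar I x = I.indicator (fun _ => (volume.real I)⁻¹) x := by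
  have hsq : 1 / √(volume.real I) * (1 / √(volume.real I)) = (volume.real I)⁻¹ := by
    rw [div_mul_div_comm, Real.mul_self_sqrt measureReal_nonneg, one_mul, one_div]
  by_cases hx : x ∈ I
  · rw [indicator_of_mem hx]
    rw [← rightHalf_union_leftHalf (I := I)] at hx
    rcases hx with hx | hx
    · rw [haar_of_mem_rightHalf hx, hsq]
    · rw [haar_of_mem_leftHalf hx, neg_mul_neg, hsq]
  · rw [haar_of_notMem hx, indicator_of_notMem hx, mul_zero]

theorem integral_mul_haar (hI : I.OrdConnected) {g : ℝ → ℝ} (hg : IntegrableOn g I) :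
    ∫ x, g x * haar I x =
      1 / √(volume.real I) * ((∫ x in rightHalf I, g x) - ∫ x in leftHalf I, g x) := by
  have hpointwise (x : ℝ) : g x * haar I x =
      1 / √(volume.real I) * ((rightHalf I).indicator g x - (leftHalf I).indicator g x) := by
    have hind (A : Set ℝ) : A.indicator g x = g x * A.indicator (fun _ => 1) x := by
      simp only [← indicator_mul_right, mul_one]
    rw [haar, hind, hind]
    ring
  have hr : Integrable ((rightHalf I).indicator g) :=
    (hg.mono_set inter_subset_left).integrable_indicator (measurableSet_rightHalf hI)
  have hl : Integrable ((leftHalf I).indicator g) :=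
    (hg.mono_set inter_subset_left).integrable_indicator (measurableSet_leftHalf hI)
  simp_rw [hpointwise]
  rw [integral_const_mul, integral_sub hr hl, integral_indicator (measurableSet_rightHalf hI),
    integral_indicator (measurableSet_leftHalf hI)]

theorem integral_haar (hI : I.OrdConnected) (hfin : volume I ≠ ∞) : ∫ x, haar I x = 0 := by
  simpa [volume_real_leftHalf hI hfin, volume_real_rightHalf hI hfin] using
    integral_mul_haar hI (g := fun _ => 1) (integrableOn_const hfin)

theorem integral_haar_mul_self (hI : I.OrdConnected) (hpos : volume.real I ≠ 0) :
    ∫ x, haar I x * haar I x = 1 := by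
  simp_rw [haar_mul_self]
  rw [integral_indicator hI.measurableSet, setIntegral_const, smul_eq_mul, mul_inv_cancel₀ hpos]

theorem haar_mul_haar_of_disjoint {J : Set ℝ} (h : Disjoint I J) (x : ℝ) :
    haar I x * haar J x = 0 := by
  by_cases hx : x ∈ I
  · rw [haar_of_notMem (disjoint_left.1 h hx), mul_zero]
  · rw [haar_of_notMem hx, zero_mul]

theorem setIntegral_eq_rightHalf_add_leftHalf (hI : I.OrdConnected) {g : ℝ → ℝ}
    (hg : IntegrableOn g I) :
    ∫ x in I, g x = (∫ x in rightHalf I, g x) + ∫ x in leftHalf I, g x := by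
  rw [← setIntegral_union disjoint_rightHalf_leftHalf (measurableSet_leftHalf hI)
    (hg.mono_set inter_subset_left) (hg.mono_set inter_subset_left), rightHalf_union_leftHalf]

theorem setAverage_rightHalf_sub_setAverage (hI : I.OrdConnected) (hfin : volume I ≠ ∞)
    {g : ℝ → ℝ} (hg : IntegrableOn g I) :
    (⨍ x in rightHalf I, g x) - ⨍ x in I, g x = (∫ x, g x * haar I x) / √(volume.real I) := by
  rw [setAverage_eq, setAverage_eq, setIntegral_eq_rightHalf_add_leftHalf hI hg,
    integral_mul_haar hI hg, volume_real_rightHalf hI hfin, mul_div_right_comm, div_div,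
    Real.mul_self_sqrt measureReal_nonneg, inv_div, smul_eq_mul, smul_eq_mul]
  ring

theorem setAverage_leftHalf_sub_setAverage (hI : I.OrdConnected) (hfin : volume I ≠ ∞)
    {g : ℝ → ℝ} (hg : IntegrableOn g I) :
    (⨍ x in leftHalf I, g x) - ⨍ x in I, g x = -((∫ x, g x * haar I x) / √(volume.real I)) := by
  rw [setAverage_eq, setAverage_eq, setIntegral_eq_rightHalf_add_leftHalf hI hg,
    integral_mul_haar hI hg, volume_real_leftHalf hI hfin, mul_div_right_comm, div_div,
    Real.mul_self_sqrt measureReal_nonneg, inv_div, smul_eq_mul, smul_eq_mul]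
  ring

end Interval

section Grid

variable {𝒟 : DyadicGrid}

theorem ordConnected (I : 𝒟.intervals) : (I : Set ℝ).OrdConnected := 𝒟.isInterval I I.2

theorem measurableSet (I : 𝒟.intervals) : MeasurableSet (I : Set ℝ) :=
  (ordConnected I).measurableSet

theorem exists_volume_real_eq_zpow (I : 𝒟.intervals) :
    ∃ k : ℤ, volume.real (I : Set ℝ) = (2 : ℝ) ^ k := by
  obtain ⟨k, hk⟩ := 𝒟.length_eq I I.2
  exact ⟨k, by rw [measureReal_def, hk, ENNReal.toReal_ofReal (by positivity)]⟩

theorem volume_real_pos (I : 𝒟.intervals) : 0 < volume.real (I : Set ℝ) := by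
  obtain ⟨k, hk⟩ := exists_volume_real_eq_zpow I
  rw [hk]
  positivity

theorem volume_ne_top (I : 𝒟.intervals) : volume (I : Set ℝ) ≠ ∞ := by
  obtain ⟨k, hk⟩ := 𝒟.length_eq I I.2
  rw [hk]
  exact ENNReal.ofReal_ne_top

theorem sInf_lt_sSup (I : 𝒟.intervals) : sInf (I : Set ℝ) < sSup I := by
  have := volume_real_pos I
  rwa [volume_real_eq_sSup_sub_sInf (ordConnected I) (volume_ne_top I), sub_pos] at this

variable (𝒟) in
/-- The member of the grid of length `2 ^ k` which contains `x`. -/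
noncomputable def cell (k : ℤ) (x : ℝ) : 𝒟.intervals :=
  ⟨((𝒟.partition k).2 x).choose, ((𝒟.partition k).2 x).choose_spec.1.1.1⟩

variable {I : 𝒟.intervals} {k : ℤ} {x y : ℝ}

variable (𝒟 k x) in
theorem mem_cell : x ∈ (𝒟.cell k x : Set ℝ) := ((𝒟.partition k).2 x).choose_spec.1.2

variable (𝒟 k x) in
theorem volume_cell : volume (𝒟.cell k x : Set ℝ) = ENNReal.ofReal ((2 : ℝ) ^ k) :=
  ((𝒟.partition k).2 x).choose_spec.1.1.2

variable (𝒟 k x) in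
theorem volume_real_cell : volume.real (𝒟.cell k x : Set ℝ) = (2 : ℝ) ^ k := by
  rw [measureReal_def, volume_cell, ENNReal.toReal_ofReal (by positivity)]

theorem cell_eq_of_mem (hI : volume.real (I : Set ℝ) = (2 : ℝ) ^ k) (hx : x ∈ (I : Set ℝ)) :
    𝒟.cell k x = I := by
  have hI' : volume (I : Set ℝ) = ENNReal.ofReal ((2 : ℝ) ^ k) := by
    rw [← hI, ofReal_measureReal (volume_ne_top I)]
  exact Subtype.ext <| ((𝒟.partition k).2 x).unique
    ⟨⟨(𝒟.cell k x).2, volume_cell 𝒟 k x⟩, mem_cell 𝒟 k x⟩ ⟨⟨I.2, hI'⟩, hx⟩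

theorem cell_eq_cell_of_mem (h : y ∈ (𝒟.cell k x : Set ℝ)) : 𝒟.cell k y = 𝒟.cell k x :=
  cell_eq_of_mem (volume_real_cell 𝒟 k x) h

theorem exists_forall_mem_cell_eq (I : 𝒟.intervals) : ∃ k, ∀ x ∈ (I : Set ℝ), 𝒟.cell k x = I :=
  (exists_volume_real_eq_zpow I).imp fun _ hk _ hx => cell_eq_of_mem hk hx

theorem disjoint_cell_of_notMem (h : y ∉ (𝒟.cell k x : Set ℝ)) :
    Disjoint (𝒟.cell k x : Set ℝ) (𝒟.cell k y) :=
  disjoint_left.2 fun _ hzx hzy =>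
    h (cell_eq_cell_of_mem hzx ▸ (cell_eq_cell_of_mem hzy).symm ▸ mem_cell 𝒟 k y)

theorem cell_subset_cell {j k : ℤ} (hjk : j ≤ k) (x : ℝ) :
    (𝒟.cell j x : Set ℝ) ⊆ 𝒟.cell k x := by
  rcases 𝒟.nested _ (𝒟.cell j x).2 _ (𝒟.cell k x).2 with hempty | hleft | hright
  · exact absurd hempty (Set.Nonempty.ne_empty ⟨x, mem_cell 𝒟 j x, mem_cell 𝒟 k x⟩)
  · exact inter_eq_left.1 hleft
  · have hvol := measureReal_mono (inter_eq_right.1 hright) (volume_ne_top (𝒟.cell j x))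
    rw [volume_real_cell, volume_real_cell, zpow_le_zpow_iff_right₀ one_lt_two] at hvol
    rw [hjk.antisymm hvol]

variable (𝒟) in
theorem countable_intervals : Countable 𝒟.intervals := by
  have hsurj : Function.Surjective fun p : ℤ × ℚ => 𝒟.cell p.1 p.2 := fun I => by
    obtain ⟨k, hk⟩ := exists_forall_mem_cell_eq I
    obtain ⟨q, hq⟩ := exists_rat_btwn (sInf_lt_sSup I)
    exact ⟨(k, q), hk q (Ioo_sInf_sSup_subset (ordConnected I) (volume_ne_top I) hq)⟩
  exact hsurj.countable

theorem exists_mem_cell_notMem_cell_sub_one (k : ℤ) (x : ℝ) :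
    ∃ y ∈ (𝒟.cell k x : Set ℝ), y ∉ (𝒟.cell (k - 1) x : Set ℝ) := by
  by_contra! hsub
  have hvol := measureReal_mono hsub (volume_ne_top (𝒟.cell (k - 1) x))
  rw [volume_real_cell, volume_real_cell, zpow_le_zpow_iff_right₀ one_lt_two] at hvol
  lia

theorem sSup_sub_sInf_cell (k : ℤ) (x : ℝ) :
    sSup (𝒟.cell k x : Set ℝ) - sInf (𝒟.cell k x : Set ℝ) = (2 : ℝ) ^ k := by
  rw [← volume_real_eq_sSup_sub_sInf (ordConnected _) (volume_ne_top _), volume_real_cell]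

theorem sInf_cell_le_sInf_cell {j k : ℤ} (hjk : j ≤ k) (hy : y ∈ (𝒟.cell k x : Set ℝ)) :
    sInf (𝒟.cell k x : Set ℝ) ≤ sInf (𝒟.cell j y : Set ℝ) := by
  rw [← cell_eq_cell_of_mem hy]
  exact csInf_le_csInf (bddBelow_of_volume_ne_top (ordConnected _) (volume_ne_top _))
    ⟨y, mem_cell 𝒟 j y⟩ (cell_subset_cell hjk y)

theorem sSup_cell_le_sSup_cell {j k : ℤ} (hjk : j ≤ k) (hy : y ∈ (𝒟.cell k x : Set ℝ)) :
    sSup (𝒟.cell j y : Set ℝ) ≤ sSup (𝒟.cell k x : Set ℝ) := by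
  rw [← cell_eq_cell_of_mem hy]
  exact csSup_le_csSup (bddAbove_of_volume_ne_top (ordConnected _) (volume_ne_top _))
    ⟨y, mem_cell 𝒟 j y⟩ (cell_subset_cell hjk y)

/-- A cell and a disjoint sibling lie in their parent, and their lengths add up to its length, which
forces the endpoints. -/
theorem sInf_sSup_cell_sub_one (k : ℤ) (x : ℝ) :
    (sInf (𝒟.cell (k - 1) x : Set ℝ) = sInf (𝒟.cell k x : Set ℝ) ∧
      sSup (𝒟.cell (k - 1) x : Set ℝ) = midpoint (𝒟.cell k x)) ∨
    (sInf (𝒟.cell (k - 1) x : Set ℝ) = midpoint (𝒟.cell k x) ∧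
      sSup (𝒟.cell (k - 1) x : Set ℝ) = sSup (𝒟.cell k x : Set ℝ)) := by
  obtain ⟨y, hyk, hyk'⟩ := exists_mem_cell_notMem_cell_sub_one (𝒟 := 𝒟) k x
  have hdisj := disjoint_cell_of_notMem hyk'
  have hk := (sub_one_lt k).le
  have hpow : (2 : ℝ) ^ k = 2 * 2 ^ (k - 1) := by rw [← zpow_one_add₀ two_ne_zero]; ring_nf
  have hxInf := sInf_cell_le_sInf_cell hk (mem_cell 𝒟 k x)
  have hxSup := sSup_cell_le_sSup_cell hk (mem_cell 𝒟 k x)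
  have hyInf := sInf_cell_le_sInf_cell hk hyk
  have hySup := sSup_cell_le_sSup_cell hk hyk
  have hparent := sSup_sub_sInf_cell (𝒟 := 𝒟) k x
  have hxlength := sSup_sub_sInf_cell (𝒟 := 𝒟) (k - 1) x
  have hylength := sSup_sub_sInf_cell (𝒟 := 𝒟) (k - 1) y
  unfold midpoint
  rcases le_total x y with hxy | hyx
  · have := csSup_le_csInf_of_disjoint (ordConnected _) (ordConnected _) hdisj
      (mem_cell 𝒟 _ x) (mem_cell 𝒟 _ y) hxy
    left; constructor <;> linarith
  · have := csSup_le_csInf_of_disjoint (ordConnected _) (ordConnected _) hdisj.symm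
      (mem_cell 𝒟 _ y) (mem_cell 𝒟 _ x) hyx
    right; constructor <;> linarith

theorem cell_sub_one_ae_eq_half (k : ℤ) (x : ℝ) :
    (𝒟.cell (k - 1) x : Set ℝ) =ᵐ[volume] leftHalf (𝒟.cell k x) ∨
      (𝒟.cell (k - 1) x : Set ℝ) =ᵐ[volume] rightHalf (𝒟.cell k x) := by
  have hIcc := ae_eq_Icc_sInf_sSup (ordConnected (𝒟.cell (k - 1) x)) (volume_ne_top _)
  rcases sInf_sSup_cell_sub_one (𝒟 := 𝒟) k x with ⟨hInf, hSup⟩ | ⟨hInf, hSup⟩ <;>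
    rw [hInf, hSup] at hIcc
  · exact Or.inl (hIcc.trans (leftHalf_ae_eq_Icc (ordConnected _) (volume_ne_top _)).symm)
  · exact Or.inr (hIcc.trans (rightHalf_ae_eq_Icc (ordConnected _) (volume_ne_top _)).symm)

end Grid

section Haar

variable {𝒟 : DyadicGrid}

theorem exists_haar_cell_ae_eq_const (k : ℤ) (x : ℝ) :
    ∃ c, ∀ᵐ y, y ∈ (𝒟.cell (k - 1) x : Set ℝ) → haar (𝒟.cell k x) y = c := by
  rcases cell_sub_one_ae_eq_half (𝒟 := 𝒟) k x with hleft | hright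
  · exact ⟨_, hleft.mem_iff.mono fun y hy hyx => haar_of_mem_leftHalf (hy.1 hyx)⟩
  · exact ⟨_, hright.mem_iff.mono fun y hy hyx => haar_of_mem_rightHalf (hy.1 hyx)⟩

theorem integral_haar_cell_mul_haar_cell {j k : ℤ} (hjk : j < k) (x : ℝ) :
    ∫ y, haar (𝒟.cell k x) y * haar (𝒟.cell j x) y = 0 := by
  obtain ⟨c, hc⟩ := exists_haar_cell_ae_eq_const (𝒟 := 𝒟) k x
  have hsub := cell_subset_cell (𝒟 := 𝒟) (Int.le_sub_one_of_lt hjk) x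
  have hconst : (fun y => haar (𝒟.cell k x) y * haar (𝒟.cell j x) y) =ᵐ[volume]
      fun y => c * haar (𝒟.cell j x) y := by
    filter_upwards [hc] with y hy
    by_cases hyj : y ∈ (𝒟.cell j x : Set ℝ)
    · rw [hy (hsub hyj)]
    · rw [haar_of_notMem hyj, mul_zero, mul_zero]
  rw [integral_congr_ae hconst, integral_const_mul,
    integral_haar (ordConnected _) (volume_ne_top _), mul_zero]

theorem integral_haar_mul_haar_of_ne {I J : 𝒟.intervals} (hIJ : I ≠ J) :
    ∫ x, haar (I : Set ℝ) x * haar (J : Set ℝ) x = 0 := by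
  rcases disjoint_or_nonempty_inter (I : Set ℝ) J with hdisj | ⟨x, hxI, hxJ⟩
  · simp only [haar_mul_haar_of_disjoint hdisj, integral_zero]
  obtain ⟨k, hk⟩ := exists_forall_mem_cell_eq I
  obtain ⟨j, hj⟩ := exists_forall_mem_cell_eq J
  rw [← hk x hxI, ← hj x hxJ] at hIJ ⊢
  rcases lt_trichotomy j k with hjk | rfl | hkj
  · exact integral_haar_cell_mul_haar_cell hjk x
  · exact absurd rfl hIJ
  · simp_rw [mul_comm (haar (𝒟.cell k x : Set ℝ) _)]
    exact integral_haar_cell_mul_haar_cell hkj x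

variable (𝒟)

theorem inner_haarL2 (f : Lp ℝ 2 (volume : Measure ℝ)) (I : 𝒟.intervals) :
    inner ℝ (𝒟.haarL2 I) f = 𝒟.haarCoeff f I := by
  rw [L2.inner_def, haarCoeff]
  refine integral_congr_ae ?_
  filter_upwards [(𝒟.memLp_haar I.2).coeFn_toLp] with x hx
  rw [haarL2, hx]
  rfl

theorem inner_haarL2_haarL2 (I J : 𝒟.intervals) :
    inner ℝ (𝒟.haarL2 I) (𝒟.haarL2 J) = ∫ x, haar (I : Set ℝ) x * haar (J : Set ℝ) x := by
  rw [real_inner_comm, inner_haarL2]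
  refine integral_congr_ae ?_
  filter_upwards [(𝒟.memLp_haar I.2).coeFn_toLp] with x hx
  rw [haarL2, hx]

theorem orthonormal_haarL2 : Orthonormal ℝ 𝒟.haarL2 := by
  refine ⟨fun I => ?_, fun I J hIJ => ?_⟩
  · rw [norm_eq_sqrt_real_inner, inner_haarL2_haarL2,
      integral_haar_mul_self (ordConnected I) (volume_real_pos I).ne', Real.sqrt_one]
  · exact (inner_haarL2_haarL2 𝒟 I J).trans (integral_haar_mul_haar_of_ne hIJ)

theorem abs_haarCoeff_le_norm (g : Lp ℝ 2 (volume : Measure ℝ)) (I : 𝒟.intervals) :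
    |𝒟.haarCoeff g I| ≤ ‖g‖ := by
  simpa only [inner_haarL2, 𝒟.orthonormal_haarL2.norm_eq_one, one_mul] using
    abs_real_inner_le_norm (𝒟.haarL2 I) g

theorem tsum_enorm_haarCoeff_sq_le (g : Lp ℝ 2 (volume : Measure ℝ)) :
    ∑' I, ‖𝒟.haarCoeff g I‖ₑ ^ 2 ≤ ‖g‖ₑ ^ 2 := by
  have hsummable := 𝒟.orthonormal_haarL2.inner_products_summable g
  have hbessel := 𝒟.orthonormal_haarL2.tsum_inner_products_le g
  simp only [inner_haarL2] at hsummable hbessel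
  simp only [← ofReal_norm, ← ENNReal.ofReal_pow (norm_nonneg _)]
  rw [← ENNReal.ofReal_tsum_of_nonneg (fun _ => sq_nonneg _) hsummable]
  exact ENNReal.ofReal_le_ofReal hbessel

theorem haarSpan_subset_sobolev (s : ℝ) : (𝒟.haarSpan : Set _) ⊆ 𝒟.sobolev s := by
  intro f hf
  obtain ⟨c, rfl⟩ := Finsupp.mem_span_range_iff_exists_finsupp.1 hf
  refine summable_of_ne_finset_zero (s := c.support) fun I hI => ?_
  rw [← Finsupp.linearCombination_apply, fracDerivTerm, ← inner_haarL2,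
    𝒟.orthonormal_haarL2.inner_right_finsupp, Finsupp.notMem_support_iff.1 hI, mul_zero, zero_smul]

theorem haarCoeff_fracDeriv {s : ℝ} {f : Lp ℝ 2 (volume : Measure ℝ)} (hf : f ∈ 𝒟.sobolev s)
    (I : 𝒟.intervals) :
    𝒟.haarCoeff (𝒟.fracDeriv s f) I = volume.real (I : Set ℝ) ^ (-s) * 𝒟.haarCoeff f I := by
  rw [← inner_haarL2, ← innerSL_apply_apply ℝ, fracDeriv, ContinuousLinearMap.map_tsum _ hf,
    tsum_eq_single I fun J hJ => by
      simp [fracDerivTerm, 𝒟.orthonormal_haarL2.inner_eq_zero hJ.symm]]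
  simp [fracDerivTerm, 𝒟.orthonormal_haarL2.norm_eq_one]

end Haar

section CellAverage

variable (𝒟 : DyadicGrid)

/-- The average of `f` over the member of length `2 ^ k` of the grid which contains `x`. -/
noncomputable def cellAverage {E : Type*} [NormedAddCommGroup E] [NormedSpace ℝ E] (f : ℝ → E)
    (k : ℤ) (x : ℝ) : E :=
  ⨍ y in 𝒟.cell k x, f y

variable {𝒟} in
theorem abs_cellAverage_sub_one_sub {f : ℝ → ℝ} {k : ℤ} {x : ℝ}
    (hf : IntegrableOn f (𝒟.cell k x)) :
    |𝒟.cellAverage f (k - 1) x - 𝒟.cellAverage f k x| =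
      |∫ y, f y * haar (𝒟.cell k x) y| / √((2 : ℝ) ^ k) := by
  have hI := ordConnected (𝒟.cell k x)
  have hfin := volume_ne_top (𝒟.cell k x)
  rw [← volume_real_cell 𝒟 k x, ← abs_of_nonneg (Real.sqrt_nonneg (volume.real _)), ← abs_div]
  unfold cellAverage
  rcases cell_sub_one_ae_eq_half (𝒟 := 𝒟) k x with hleft | hright
  · rw [Measure.restrict_congr_set hleft, setAverage_leftHalf_sub_setAverage hI hfin hf, abs_neg]
  · rw [Measure.restrict_congr_set hright, setAverage_rightHalf_sub_setAverage hI hfin hf]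

theorem tendsto_two_zpow_atTop : Tendsto (fun k : ℤ => (2 : ℝ) ^ k) atTop atTop := by
  simpa only [Function.comp_def, Real.rpow_intCast] using
    (tendsto_rpow_atTop_of_base_gt_one (2 : ℝ) one_lt_two).comp tendsto_intCast_atTop_atTop

theorem tendsto_cellAverage_atTop (f : Lp ℝ 2 (volume : Measure ℝ)) (x : ℝ) :
    Tendsto (fun k => 𝒟.cellAverage f k x) atTop (𝓝 0) := by
  refine squeeze_zero_norm (fun k => ?_)
    ((Real.tendsto_sqrt_atTop.comp tendsto_two_zpow_atTop).const_div_atTop ‖f‖)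
  simpa only [volume_real_cell, Real.norm_eq_abs, Function.comp_apply, cellAverage] using
    abs_setAverage_le_norm_div_sqrt (measurableSet (𝒟.cell k x)) (volume_ne_top _) f

theorem closedBall_midpoint_cell (k : ℤ) (x : ℝ) :
    Metric.closedBall (midpoint (𝒟.cell k x)) ((2 : ℝ) ^ k / 2) =
      Icc (sInf (𝒟.cell k x : Set ℝ)) (sSup (𝒟.cell k x : Set ℝ)) := by
  rw [Real.closedBall_eq_Icc, midpoint, ← volume_real_cell 𝒟 k x,
    volume_real_eq_sSup_sub_sInf (ordConnected _) (volume_ne_top _)]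
  ring_nf

theorem ae_tendsto_cellAverage_atBot {E : Type*} [NormedAddCommGroup E] [NormedSpace ℝ E]
    [CompleteSpace E] {f : ℝ → E} (hf : LocallyIntegrable f) :
    ∀ᵐ x, Tendsto (fun k => 𝒟.cellAverage f k x) atBot (𝓝 (f x)) := by
  have hradius : Tendsto (fun k : ℤ => (2 : ℝ) ^ k / 2) atBot (𝓝[>] 0) := by
    refine tendsto_nhdsWithin_iff.2 ⟨?_, Eventually.of_forall fun k => mem_Ioi.2 (by positivity)⟩
    simpa using ((tendsto_two_zpow_atTop.comp tendsto_neg_atBot_atTop).inv_tendsto_atTop).div_const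
      (2 : ℝ)
  filter_upwards [IsUnifLocDoublingMeasure.ae_tendsto_average volume hf 1] with x hx
  refine (hx (fun k => midpoint (𝒟.cell k x)) _ hradius (Eventually.of_forall fun k => ?_)).congr
    fun k => ?_
  · rw [one_mul, closedBall_midpoint_cell]
    exact subset_Icc_sInf_sSup (ordConnected _) (volume_ne_top _) (mem_cell 𝒟 k x)
  · rw [closedBall_midpoint_cell, cellAverage, Measure.restrict_congr_set
      (ae_eq_Icc_sInf_sSup (ordConnected (𝒟.cell k x)) (volume_ne_top _))]

end CellAverage

section SquareFunction

variable (𝒟 : DyadicGrid) (g : Lp ℝ 2 (volume : Measure ℝ))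

/-- The dyadic square function `S(g) = (∑_{I ∈ 𝒟} |(g, h_I)|² |I|⁻¹ 1_I)^{1/2}`, with values in
`[0, ∞]`. -/
noncomputable def squareFunction (x : ℝ) : ℝ≥0∞ :=
  (∑' I : 𝒟.intervals, (I : Set ℝ).indicator
    (fun _ => ‖𝒟.haarCoeff g I‖ₑ ^ 2 / volume (I : Set ℝ)) x) ^ (1 / 2 : ℝ)

theorem measurable_squareFunction : Measurable (𝒟.squareFunction g) := by
  have := 𝒟.countable_intervals
  exact (Measurable.tsum fun I => measurable_const.indicator (measurableSet I)).pow_const _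

theorem lintegral_squareFunction_sq :
    ∫⁻ x, 𝒟.squareFunction g x ^ (2 : ℝ) = ∑' I, ‖𝒟.haarCoeff g I‖ₑ ^ 2 := by
  have := 𝒟.countable_intervals
  simp only [squareFunction, ← ENNReal.rpow_mul, one_div, inv_mul_cancel₀ (two_ne_zero' ℝ),
    ENNReal.rpow_one]
  rw [lintegral_tsum fun I => (measurable_const.indicator (measurableSet I)).aemeasurable]
  refine tsum_congr fun I => ?_
  rw [lintegral_indicator_const (measurableSet I), ENNReal.div_mul_cancel
    ((measureReal_ne_zero_iff (volume_ne_top I)).1 (volume_real_pos I).ne') (volume_ne_top I)]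

theorem eLpNorm_squareFunction_le : eLpNorm (𝒟.squareFunction g) 2 volume ≤ ‖g‖ₑ := by
  rw [eLpNorm_eq_lintegral_rpow_enorm_toReal two_ne_zero ENNReal.ofNat_ne_top,
    ENNReal.toReal_ofNat]
  simp only [enorm_eq_self, lintegral_squareFunction_sq]
  refine (ENNReal.rpow_le_rpow (𝒟.tsum_enorm_haarCoeff_sq_le g) (by positivity)).trans_eq ?_
  rw [← ENNReal.rpow_natCast_mul]
  simp

theorem ae_squareFunction_lt_top : ∀ᵐ x, 𝒟.squareFunction g x < ∞ := by
  have hsq : ∫⁻ x, 𝒟.squareFunction g x ^ (2 : ℝ) ≠ ∞ := by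
    rw [lintegral_squareFunction_sq]
    exact ne_top_of_le_ne_top (by finiteness) (𝒟.tsum_enorm_haarCoeff_sq_le g)
  filter_upwards [ae_lt_top ((𝒟.measurable_squareFunction g).pow_const _) hsq] with x hx
  exact (ENNReal.rpow_lt_top_iff_of_pos two_pos).1 hx

theorem eLpNorm_toReal_squareFunction_le :
    eLpNorm (fun x => (𝒟.squareFunction g x).toReal) 2 volume ≤ ‖g‖ₑ := by
  have hcongr : ∀ᵐ x, ‖(𝒟.squareFunction g x).toReal‖ₑ = ‖𝒟.squareFunction g x‖ₑ := by
    filter_upwards [𝒟.ae_squareFunction_lt_top g] with x hx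
    rw [Real.enorm_toReal hx.ne, enorm_eq_self]
  exact (eLpNorm_congr_enorm_ae hcongr).trans_le (𝒟.eLpNorm_squareFunction_le g)

variable {𝒟 g}

theorem abs_haarCoeff_div_sqrt_le_squareFunction {x : ℝ} (hx : 𝒟.squareFunction g x < ∞)
    {I : 𝒟.intervals} (hxI : x ∈ (I : Set ℝ)) :
    |𝒟.haarCoeff g I| / √(volume.real (I : Set ℝ)) ≤ (𝒟.squareFunction g x).toReal := by
  have hterm : ‖𝒟.haarCoeff g I‖ₑ ^ 2 / volume (I : Set ℝ) ≤ ∑' I : 𝒟.intervals,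
      (I : Set ℝ).indicator (fun _ => ‖𝒟.haarCoeff g I‖ₑ ^ 2 / volume (I : Set ℝ)) x :=
    (indicator_of_mem hxI fun _ => _).symm.le.trans (ENNReal.le_tsum I)
  have hroot := ENNReal.toReal_mono hx.ne
    (ENNReal.rpow_le_rpow hterm (by norm_num : (0 : ℝ) ≤ 1 / 2))
  rwa [← ENNReal.toReal_rpow, ENNReal.toReal_div, ENNReal.toReal_pow, toReal_enorm,
    ← measureReal_def, ← Real.sqrt_eq_rpow, Real.sqrt_div (sq_nonneg _),
    Real.sqrt_sq (norm_nonneg _), Real.norm_eq_abs] at hroot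

end SquareFunction

section SobolevInequality

variable {𝒟 : DyadicGrid} {s : ℝ} {f g : Lp ℝ 2 (volume : Measure ℝ)}

/-- Hedberg's inequality; its hypothesis holds with equality for `g = D^s f`. -/
theorem ae_abs_le_squareFunction_rpow_mul (hs0 : 0 < s) (hs1 : s < 1 / 2)
    (hfg : ∀ I : 𝒟.intervals,
      |𝒟.haarCoeff f I| ≤ volume.real (I : Set ℝ) ^ s * |𝒟.haarCoeff g I|) :
    ∀ᵐ x, |f x| ≤ hedbergConst 2 s (1 / 2 - s) *
      ((𝒟.squareFunction g x).toReal ^ (1 - 2 * s) * ‖g‖ ^ (2 * s)) := by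
  have hloc : LocallyIntegrable f := (Lp.memLp f).locallyIntegrable one_le_two
  filter_upwards [𝒟.ae_tendsto_cellAverage_atBot hloc, 𝒟.ae_squareFunction_lt_top g] with x hx hSx
  have hincrement (k : ℤ) : dist (𝒟.cellAverage f (k - 1) x) (𝒟.cellAverage f k x) ≤
      ((2 : ℝ) ^ k) ^ s * (|𝒟.haarCoeff g (𝒟.cell k x)| / √((2 : ℝ) ^ k)) := by
    have hint : IntegrableOn f (𝒟.cell k x) :=
      integrableOn_Lp_of_measure_ne_top f one_le_two (volume_ne_top _)
    rw [Real.dist_eq, abs_cellAverage_sub_one_sub hint, ← mul_div_assoc,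
      ← volume_real_cell 𝒟 k x]
    gcongr
    exact hfg _
  have hsquare (k : ℤ) : dist (𝒟.cellAverage f (k - 1) x) (𝒟.cellAverage f k x) ≤
      ((2 : ℝ) ^ k) ^ s * (𝒟.squareFunction g x).toReal := by
    refine (hincrement k).trans ?_
    gcongr
    rw [← volume_real_cell 𝒟 k x]
    exact abs_haarCoeff_div_sqrt_le_squareFunction hSx (mem_cell 𝒟 k x)
  have hnorm (k : ℤ) : dist (𝒟.cellAverage f (k - 1) x) (𝒟.cellAverage f k x) ≤
      ((2 : ℝ) ^ k) ^ (-(1 / 2 - s)) * ‖g‖ := by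
    have hpow : ((2 : ℝ) ^ k) ^ (-(1 / 2 - s)) = ((2 : ℝ) ^ k) ^ s / √((2 : ℝ) ^ k) := by
      rw [Real.sqrt_eq_rpow, ← Real.rpow_sub (by positivity), neg_sub]
    rw [hpow, div_mul_eq_mul_div, mul_div_assoc]
    refine (hincrement k).trans ?_
    gcongr
    exact 𝒟.abs_haarCoeff_le_norm g _
  have hhedberg := dist_le_hedbergConst_mul one_lt_two hs0 (sub_pos.2 hs1) ENNReal.toReal_nonneg
    (norm_nonneg g) hsquare hnorm hx (𝒟.tendsto_cellAverage_atTop f x)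
  have hexp₁ : (1 / 2 - s) / (s + (1 / 2 - s)) = 1 - 2 * s := by ring
  have hexp₂ : s / (s + (1 / 2 - s)) = 2 * s := by ring
  rwa [dist_zero_right, Real.norm_eq_abs, hexp₁, hexp₂] at hhedberg

theorem eLpNorm_le_hedbergConst_mul_norm (hs0 : 0 < s) (hs1 : s < 1 / 2)
    (hfg : ∀ I : 𝒟.intervals,
      |𝒟.haarCoeff f I| ≤ volume.real (I : Set ℝ) ^ s * |𝒟.haarCoeff g I|) :
    eLpNorm f (ENNReal.ofReal (2 / (1 - 2 * s))) volume ≤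
      ENNReal.ofReal (hedbergConst 2 s (1 / 2 - s) * ‖g‖) := by
  have hr : 0 < 1 - 2 * s := by linarith
  have hC : 0 < hedbergConst 2 s (1 / 2 - s) := hedbergConst_pos one_lt_two hs0 (sub_pos.2 hs1)
  have hq : ENNReal.ofReal (2 / (1 - 2 * s)) * ENNReal.ofReal (1 - 2 * s) = 2 := by
    rw [← ENNReal.ofReal_mul (by positivity), div_mul_cancel₀ _ hr.ne', ENNReal.ofReal_ofNat]
  have hpointwise : ∀ᵐ x, ‖f x‖ ≤ hedbergConst 2 s (1 / 2 - s) * ‖g‖ ^ (2 * s) *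
      ‖(𝒟.squareFunction g x).toReal‖ ^ (1 - 2 * s) := by
    filter_upwards [ae_abs_le_squareFunction_rpow_mul hs0 hs1 hfg] with x hx
    rwa [Real.norm_eq_abs, Real.norm_of_nonneg ENNReal.toReal_nonneg, mul_assoc,
      mul_comm (‖g‖ ^ _)]
  calc eLpNorm f (ENNReal.ofReal (2 / (1 - 2 * s))) volume
      ≤ ENNReal.ofReal (hedbergConst 2 s (1 / 2 - s) * ‖g‖ ^ (2 * s)) *
          eLpNorm (fun x => (𝒟.squareFunction g x).toReal) 2 volume ^ (1 - 2 * s) := by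
        simpa only [hq] using
          eLpNorm_le_mul_eLpNorm_rpow hr hpointwise (ENNReal.ofReal (2 / (1 - 2 * s)))
    _ ≤ ENNReal.ofReal (hedbergConst 2 s (1 / 2 - s) * ‖g‖ ^ (2 * s)) *
          ‖g‖ₑ ^ (1 - 2 * s) := by
        gcongr
        exact 𝒟.eLpNorm_toReal_squareFunction_le g
    _ = ENNReal.ofReal (hedbergConst 2 s (1 / 2 - s) * ‖g‖) := by
        rw [← ofReal_norm, ENNReal.ofReal_rpow_of_nonneg (norm_nonneg _) hr.le,
          ← ENNReal.ofReal_mul (by positivity), mul_assoc,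
          ← Real.rpow_add_of_nonneg (norm_nonneg _) (by positivity) hr.le,
          add_sub_cancel, Real.rpow_one]

theorem eLpNorm_le_hedbergConst_mul_homSeminorm (hs0 : 0 < s) (hs1 : s < 1 / 2)
    (hf : f ∈ 𝒟.sobolev s) :
    eLpNorm f (ENNReal.ofReal (2 / (1 - 2 * s))) volume ≤
      ENNReal.ofReal (hedbergConst 2 s (1 / 2 - s) * 𝒟.homSeminorm s f) := by
  refine eLpNorm_le_hedbergConst_mul_norm (𝒟 := 𝒟) (g := 𝒟.fracDeriv s f) hs0 hs1 fun I => ?_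
  have hpos := volume_real_pos I
  rw [haarCoeff_fracDeriv 𝒟 hf, abs_mul, Real.abs_rpow_of_nonneg hpos.le, abs_of_pos hpos,
    ← mul_assoc, ← Real.rpow_add hpos, add_neg_cancel, Real.rpow_zero, one_mul]

end SobolevInequality

end DyadicGrid

theorem mainTheorem3 (s : ℝ) (hs0 : 0 < s) (hs1 : s < 1 / 2) :
    ∃ C : ℝ, 0 < C ∧ ∀ 𝒟 : DyadicGrid,
      (∀ f ∈ 𝒟.haarSpan, f ∈ 𝒟.sobolev s ∧
        eLpNorm f (ENNReal.ofReal (2 / (1 - 2 * s))) volume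
          ≤ ENNReal.ofReal (C * 𝒟.homSeminorm s f)) ∧
      (∀ f ∈ 𝒟.sobolev s,
        MemLp f (ENNReal.ofReal (2 / (1 - 2 * s))) volume ∧
        eLpNorm f (ENNReal.ofReal (2 / (1 - 2 * s))) volume
          ≤ ENNReal.ofReal (C * 𝒟.homSeminorm s f)) := by
  refine ⟨hedbergConst 2 s (1 / 2 - s), hedbergConst_pos one_lt_two hs0 (sub_pos.2 hs1),
    fun 𝒟 => ?_⟩
  have hbound {f} (hf : f ∈ 𝒟.sobolev s) :=
    DyadicGrid.eLpNorm_le_hedbergConst_mul_homSeminorm hs0 hs1 hf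
  refine ⟨fun f hf => ?_, fun f hf => ?_⟩
  · have hfs := 𝒟.haarSpan_subset_sobolev s hf
    exact ⟨hfs, hbound hfs⟩
  · exact ⟨⟨Lp.aestronglyMeasurable f, (hbound hf).trans_lt ENNReal.ofReal_lt_top⟩, hbound hf⟩
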